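/- Conventions. An argumentation framework (AF) is a pair $\mathcal F=(A,R)$ with $R\subseteq A\times A$; $a$ attacks $b$ if $(a,b)\in R$. A set $S\subseteq A$ is admissible if no element of $S$ attacks an element of $S$, and every argument that attacks an element of $S$ is attacked by some element of $S$. Let $\mathrm{infad}(\mathcal F)$ be the collection of infinite admissible sets $S\subseteq A$. Fix a computable enumeration $(\varphi_e)_{e\in\mathbb N}$ of all partial computable functions, i.e. $(e,x)\mapsto\varphi_e(x)$ is partial computable and every partial computable function is some $\varphi_e$, and a computable bijection $(x,y)\mapsto\langle x,y\rangle$ from $\mathbb N^2$ to $\mathbb N$. Let $D_y$ be the finite set $\{x_1,\dots,x_n\}$ of natural numbers (with distinct $x_i$) such that $y=2^{x_1}+\dots+2^{x_n}$. Let $\mathrm{Tot}=\{e:\varphi_e\text{ is total}\}$. For $e\in\mathrm{Tot}$ let $\mathcal F_e$ be the AF with arguments $a_0,a_1,\dots$ (pairwise distinct) in which $a_n$ attacks $a_m$ if and only if $n\in D_{\varphi_e(m)}$. Put $$\mathrm{Exists}=\{e\in\mathrm{Tot}:\mathrm{infad}(\mathcal F_e)\neq\emptyset\},$$ $$\mathrm{Cred}=\{\langle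 e,n\rangle: e\in\mathrm{Tot}\text{ and } a_n\in S\text{ for some }S\in\mathrm{infad}(\mathcal F_e)\},$$ $$\mathrm{Skept}=\{\langle e,n\rangle: e\in\mathrm{Tot}\text{ and } a_n\in S\text{ for every }S\in\mathrm{infad}(\mathcal F_e)\}.$$ A set $X\subseteq\mathbb N$ is $\Sigma^0_2$ if there is a computable relation $R\subseteq\mathbb N^3$ such that $x\in X\iff\exists y\,\forall z\,R(x,y,z)$, and $\Pi^0_2$ if its complement is $\Sigma^0_2$. It is $u$-$\Sigma^0_2$ if it is the union of a $\Sigma^0_2$ set and a $\Pi^0_2$ set, and $d$-$\Sigma^0_2$ if it is the intersection of a $\Sigma^0_2$ set and a $\Pi^0_2$ set. For a class $\Gamma$ of subsets of $\mathbb N$, a set $P$ is $\Gamma$ within $X$ if $P=Q\cap X$ for some $Q\in\Gamma$. Theorem. $\mathrm{Exists}$ is $u$-$\Sigma^0_2$ within $\mathrm{Tot}$, $\mathrm{Cred}$ is $u$-$\Sigma^0_2$ within $\{\langle e,n\rangle:e\in\mathrm{Tot},\,n\in\mathbb N\}$, and $\mathrm{Skept}$ is $d$-$\Sigma^0_2$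 within $\{\langle e,n\rangle:e\in\mathrm{Tot},\,n\in\mathbb N\}$. -/

import Mathlib

/-- An argumentation framework on the set of arguments `A`: `F.attacks a b` says that `a`
attacks `b`. -/
@[ext]
structure ArgFramework (A : Type*) where
  attacks : A → A → Prop

namespace ArgFramework

variable {A : Type*}

/-- The set of arguments that `S` attacks. -/
def attackedBy (F : ArgFramework A) (S : Set A) : Set A := {x | ∃ y ∈ S, F.attacks y x}

/-- The set of arguments that attack some element of `S`. -/
def attackers (F : ArgFramework A) (S : Set A) : Set A := {x | ∃ y ∈ S, F.attacks x y}

/-- `S` defends `a`: every attacker of `a` is attacked by an element of `S`. -/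
def Defends (F : ArgFramework A) (S : Set A) (a : A) : Prop :=
  F.attackers {a} ⊆ F.attackedBy S

/-- The characteristic function of the framework. -/
def charFun (F : ArgFramework A) (S : Set A) : Set A := {x | F.Defends S x}

/-- The conflict-free extensions. -/
def cf (F : ArgFramework A) : Set (Set A) := {S | ∀ a ∈ S, ∀ b ∈ S, ¬ F.attacks a b}

/-- The admissible extensions: conflict-free and self-defending. -/
def ad (F : ArgFramework A) : Set (Set A) := {S | S ∈ F.cf ∧ S ⊆ F.charFun S}

/-- The infinite admissible extensions. -/
def infad (F : ArgFramework A) : Set (Set A) := {S | S ∈ F.ad ∧ S.Infinite}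

end ArgFramework

namespace FinitaryAF

/-- A computable enumeration `(φ_e)` of all partial computable functions: the map
`(e, x) ↦ φ_e(x)` is partial computable, and every partial computable function is some `φ_e`. -/
def IsComputableEnumeration (φ : ℕ → ℕ →. ℕ) : Prop :=
  Partrec₂ φ ∧ ∀ f : ℕ →. ℕ, Nat.Partrec f → ∃ e, φ e = f

/-- A computable bijective pairing function. -/
def IsPairing (p : ℕ → ℕ → ℕ) : Prop :=
  Computable₂ p ∧ Function.Bijective (fun t : ℕ × ℕ => p t.1 t.2)

/-- The finite set with canonical index `y`, i.e. the set of positions of the binary digits `1`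
of `y`. -/
def canonicalSet (y : ℕ) : Finset ℕ := y.bitIndices.toFinset

theorem sum_canonicalSet (y : ℕ) : ∑ x ∈ canonicalSet y, 2 ^ x = y :=
  Finset.sum_toFinset_bitIndices_two_pow y

/-- The set of indices of total computable functions. -/
def tot (φ : ℕ → ℕ →. ℕ) : Set ℕ := {e | ∀ m, (φ e m).Dom}

/-- The set of pairs `⟨e, n⟩` with `e ∈ tot φ` and `n` arbitrary. -/
def totProd (φ : ℕ → ℕ →. ℕ) (p : ℕ → ℕ → ℕ) : Set ℕ := {x | ∃ e ∈ tot φ, ∃ n, x = p e n}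

/-- `e` is a computable index for the (finitary) framework `F` on the arguments `a_0, a_1, …`,
where `a_n` is identified with `n`: each `φ_e(m)` is defined, and it is the canonical index of
the set of attackers of `m`. -/
def IsIndex (φ : ℕ → ℕ →. ℕ) (e : ℕ) (F : ArgFramework ℕ) : Prop :=
  ∀ n m, ∃ y ∈ φ e m, (F.attacks n m ↔ n ∈ canonicalSet y)

/-- A number indexes at most one framework. -/
theorem IsIndex.unique {φ : ℕ → ℕ →. ℕ} {e : ℕ} {F G : ArgFramework ℕ}
    (hF : IsIndex φ e F) (hG : IsIndex φ e G) : F = G := by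
  ext n m
  obtain ⟨y, hy, h⟩ := hF n m
  obtain ⟨z, hz, h'⟩ := hG n m
  rw [h, h', Part.mem_unique hy hz]

/-- A number indexes a framework iff it indexes a total function. -/
theorem exists_isIndex_iff {φ : ℕ → ℕ →. ℕ} {e : ℕ} :
    (∃ F, IsIndex φ e F) ↔ e ∈ tot φ := by
  constructor
  · rintro ⟨F, hF⟩ m
    obtain ⟨y, hy, -⟩ := hF 0 m
    exact Part.dom_iff_mem.2 ⟨y, hy⟩
  · intro h
    exact ⟨⟨fun n m => n ∈ canonicalSet ((φ e m).get (h m))⟩,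
      fun n m => ⟨_, Part.get_mem (h m), Iff.rfl⟩⟩

/-- The indices of frameworks that have an infinite admissible extension. -/
def existsInfad (φ : ℕ → ℕ →. ℕ) : Set ℕ :=
  {e | ∃ F, IsIndex φ e F ∧ ∃ S, S ∈ F.infad}

/-- The pairs `⟨e, n⟩` such that `a_n` is in some infinite admissible extension of `F_e`. -/
def credInfad (φ : ℕ → ℕ →. ℕ) (p : ℕ → ℕ → ℕ) : Set ℕ :=
  {x | ∃ e n, x = p e n ∧ ∃ F, IsIndex φ e F ∧ ∃ S ∈ F.infad, n ∈ S}

/-- The pairs `⟨e, n⟩` such that `a_n` is in every infinite admissible extension of `F_e`. -/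
def skepInfad (φ : ℕ → ℕ →. ℕ) (p : ℕ → ℕ → ℕ) : Set ℕ :=
  {x | ∃ e n, x = p e n ∧ ∃ F, IsIndex φ e F ∧ ∀ S ∈ F.infad, n ∈ S}

/-- `X` is a `Σ⁰₂` set. -/
def IsSigma2 (X : Set ℕ) : Prop :=
  ∃ R : ℕ → ℕ → ℕ → Prop, ComputablePred (fun t : ℕ × ℕ × ℕ => R t.1 t.2.1 t.2.2) ∧
    ∀ x, x ∈ X ↔ ∃ y, ∀ z, R x y z

/-- `X` is a `Π⁰₂` set. -/
def IsPi2 (X : Set ℕ) : Prop := IsSigma2 Xᶜ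

/-- `X` is a `u-Σ⁰₂` set. -/
def IsUSigma2 (X : Set ℕ) : Prop := ∃ Y Z, IsSigma2 Y ∧ IsPi2 Z ∧ X = Y ∪ Z

/-- `X` is a `d-Σ⁰₂` set. -/
def IsDSigma2 (X : Set ℕ) : Prop := ∃ Y Z, IsSigma2 Y ∧ IsPi2 Z ∧ X = Y ∩ Z

/-- The problem `P` is `Γ` within `X`. -/
def IsWithin (Γ : Set ℕ → Prop) (X P : Set ℕ) : Prop := ∃ R, Γ R ∧ P = R ∩ X

end FinitaryAF

/-! All three problems ask for an infinite admissible set that includes a finite `K` and is disjoint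
from a finite `L`; for Skept, such a set with `L = {n}` is a counterexample. It exists iff some
argument lies in an admissible set between `K` and `L` but in no finite one, or the finite ones
contain arbitrarily large arguments (`exists_infinite_iff`). The unbounded case is the substantial
one: a maximal admissible set above an ultralimit of the finite sets cannot be finite, since it
could absorb one more of them.

As attacker sets are finite and computable, being a finite admissible set is Σ⁰₁
(`exists_certified_iff`), and by compactness the existence of an admissible set with given
constraints is Π⁰₁ (`exists_adBetween_iff`). So the first alternative is ∃ before Π⁰₁, hence Σ⁰₂,
and the second is ∀ before Σ⁰₁, hence Π⁰₂. -/

open Filter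

/-! ### Admissible sets in finitary frameworks: limits and maximality -/

namespace ArgFramework

/-- The admissible extensions of `F` that include `K` and are disjoint from `L`. -/
def adBetween {A : Type*} (F : ArgFramework A) (K L : Set A) : Set (Set A) :=
  {S | S ∈ F.ad ∧ K ⊆ S ∧ Disjoint S L}

/-- Admissibility as a family of requirements, one per attack. For finitely many attackers each
involves finitely many arguments, so it passes to limits. -/
theorem mem_ad_iff {A : Type*} {F : ArgFramework A} {S : Set A} :
    S ∈ F.ad ↔ ∀ a ∈ S, ∀ b, F.attacks b a → b ∉ S ∧ ∃ c, F.attacks c b ∧ c ∈ S := by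
  constructor
  · rintro ⟨hcf, hd⟩ a ha b hba
    refine ⟨fun hb => hcf b hb a ha hba, ?_⟩
    obtain ⟨c, hc, hcb⟩ := hd ha (show b ∈ F.attackers {a} from ⟨a, rfl, hba⟩)
    exact ⟨c, hcb, hc⟩
  · intro h
    refine ⟨fun a ha b hb hab => (h b hb a hab).1 ha, ?_⟩
    rintro a ha b ⟨_, rfl, hba⟩
    obtain ⟨c, hcb, hc⟩ := (h _ ha b hba).2
    exact ⟨c, hc, hcb⟩

/-- Two admissible extensions have an admissible union as soon as the second one does not attack
the first. -/
theorem union_mem_ad {A : Type*} {F : ArgFramework A} {S T : Set A} (hS : S ∈ F.ad)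
    (hT : T ∈ F.ad) (h : ∀ a ∈ S, ∀ b ∈ T, ¬ F.attacks b a) : S ∪ T ∈ F.ad := by
  rw [mem_ad_iff] at *
  rintro a (ha | ha) b hba
  · obtain ⟨h1, c, hcb, hc⟩ := hS a ha b hba
    exact ⟨fun hb => hb.elim h1 fun hb => h a ha b hb hba, c, hcb, Or.inl hc⟩
  · obtain ⟨h1, c, hcb, hc⟩ := hT a ha b hba
    -- If `b ∈ S` attacked `a ∈ T`, the defender `c ∈ T` would attack `b ∈ S`, against `h`.
    exact ⟨fun hb => hb.elim (fun hb => h b hb c hc hcb) h1, c, hcb, Or.inr hc⟩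

/-- The limit of a sequence of sets along an ultrafilter on the indices. -/
def ultralimit {A : Type*} (T : ℕ → Set A) : Set A := {a | ∀ᶠ k in hyperfilter ℕ, a ∈ T k}

theorem eventually_hyperfilter {P : ℕ → Prop} (h : ∀ᶠ k in atTop, P k) :
    ∀ᶠ k in hyperfilter ℕ, P k := Nat.hyperfilter_le_atTop h

/-- If every local requirement of admissibility is eventually met by the sets `T k`, then their
ultralimit is admissible. -/
theorem ultralimit_mem_ad {A : Type*} {F : ArgFramework A}
    (hF : ∀ a, {b | F.attacks b a}.Finite) {T : ℕ → Set A}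
    (hT : ∀ a b, F.attacks b a → ∀ᶠ k in atTop,
      a ∈ T k → b ∉ T k ∧ ∃ c, F.attacks c b ∧ c ∈ T k) :
    ultralimit T ∈ F.ad := by
  rw [mem_ad_iff]
  intro a ha b hba
  have key : ∀ᶠ k in hyperfilter ℕ, b ∉ T k ∧ ∃ c, F.attacks c b ∧ c ∈ T k := by
    filter_upwards [ha, eventually_hyperfilter (hT a b hba)] with k h1 h2 using h2 h1
  refine ⟨Ultrafilter.eventually_not.1 (key.mono fun k h => h.1), ?_⟩
  -- The defender may vary with `k`, but `b` has finitely many attackers, so the ultrafilter selects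
  -- a single one.
  have h2 : (⋃ c ∈ {c | F.attacks c b}, {k | c ∈ T k}) ∈ hyperfilter ℕ := by
    filter_upwards [key] with k hk
    simpa using hk.2
  obtain ⟨c, hc, h⟩ := (Ultrafilter.finite_biUnion_mem_iff (hF b)).1 h2
  exact ⟨c, hc, h⟩

theorem ultralimit_mem_adBetween {A : Type*} {F : ArgFramework A}
    (hF : ∀ a, {b | F.attacks b a}.Finite) {K L : Set A} {T : ℕ → Set A}
    (hT : ∀ a b, F.attacks b a → ∀ᶠ k in atTop,
      a ∈ T k → b ∉ T k ∧ ∃ c, F.attacks c b ∧ c ∈ T k)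
    (hK : ∀ a ∈ K, ∀ᶠ k in atTop, a ∈ T k) (hL : ∀ a ∈ L, ∀ᶠ k in atTop, a ∉ T k) :
    ultralimit T ∈ F.adBetween K L := by
  refine ⟨ultralimit_mem_ad hF hT, fun a ha => eventually_hyperfilter (hK a ha), ?_⟩
  rw [Set.disjoint_right]
  intro a ha
  exact Ultrafilter.eventually_not.1 (eventually_hyperfilter (hL a ha))

/-- Zorn's lemma: any conflict in the union of a chain already occurs within one member, and
defenders are inherited. -/
theorem exists_maximal_adBetween {A : Type*} {F : ArgFramework A} {K L S : Set A}
    (hS : S ∈ F.adBetween K L) : ∃ M, S ⊆ M ∧ Maximal (· ∈ F.adBetween K L) M := by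
  refine zorn_subset_nonempty _ (fun c hc hchain hne => ⟨⋃₀ c, ?_, fun s hs =>
    Set.subset_sUnion_of_mem hs⟩) S hS
  obtain ⟨s₀, hs₀⟩ := hne
  refine ⟨mem_ad_iff.2 ?_, (hc hs₀).2.1.trans (Set.subset_sUnion_of_mem hs₀), ?_⟩
  · rintro a ⟨s, hs, has⟩ b hba
    obtain ⟨-, d, hdb, hd⟩ := mem_ad_iff.1 (hc hs).1 a has b hba
    refine ⟨?_, d, hdb, s, hs, hd⟩
    rintro ⟨t, ht, hbt⟩
    rcases hchain.total hs ht with h | h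
    · exact (mem_ad_iff.1 (hc ht).1 a (h has) b hba).1 hbt
    · exact (mem_ad_iff.1 (hc hs).1 a has b hba).1 (h hbt)
  · exact Set.disjoint_sUnion_left.2 fun s hs => (hc hs).2.2

/-- In a finitary framework, unboundedly many arguments in finite admissible extensions yield an
infinite admissible extension. -/
theorem exists_infinite_of_unbounded {F : ArgFramework ℕ}
    (hF : ∀ a, {b | F.attacks b a}.Finite) {K L : Set ℕ}
    (h : ∀ N, ∃ T ∈ F.adBetween K L, ∃ b ∈ T, N ≤ b) :
    ∃ S ∈ F.adBetween K L, S.Infinite := by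
  choose T hT b hbT hb using h
  have hlim : ultralimit T ∈ F.adBetween K L :=
    ultralimit_mem_adBetween hF
      (fun a b hba => .of_forall fun k ha => mem_ad_iff.1 (hT k).1 a ha b hba)
      (fun a ha => .of_forall fun k => (hT k).2.1 ha)
      (fun a ha => .of_forall fun k => Set.disjoint_right.1 (hT k).2.2 ha)
  obtain ⟨M, hSM, hM⟩ := exists_maximal_adBetween hlim
  refine ⟨M, hM.prop, fun hfin => ?_⟩
  have hatt : {x | ∃ a ∈ M, F.attacks x a}.Finite := by
    have : {x | ∃ a ∈ M, F.attacks x a} = ⋃ a ∈ M, {x | F.attacks x a} := by ext; simp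
    rw [this]
    exact hfin.biUnion fun a _ => hF a
  -- The finitely many attackers of `M` lie outside `M`, hence outside the ultralimit, so almost
  -- every `T k` avoids them all.
  have h1 : ∀ᶠ k in hyperfilter ℕ, ∀ x ∈ {x | ∃ a ∈ M, F.attacks x a}, x ∉ T k := by
    rw [eventually_all_finite hatt]
    rintro x ⟨a, ha, hxa⟩
    exact Ultrafilter.eventually_not.2 fun hx =>
      (mem_ad_iff.1 hM.prop.1 a ha x hxa).1 (hSM hx)
  obtain ⟨N, hN⟩ := hfin.bddAbove
  obtain ⟨k, hk, hNk⟩ := (h1.and (eventually_hyperfilter (eventually_gt_atTop N))).exists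
  -- By maximality `T k ⊆ M`, although `T k` has an element that is at least `k > N`.
  have hU : M ∪ T k ∈ F.adBetween K L :=
    ⟨union_mem_ad hM.prop.1 (hT k).1 fun a ha b hb hba => hk b ⟨a, ha, hba⟩ hb,
      hM.prop.2.1.trans Set.subset_union_left,
      Set.disjoint_union_left.2 ⟨hM.prop.2.2, (hT k).2.2⟩⟩
  have := hN (hM.le_of_ge hU Set.subset_union_left (Or.inr (hbT k)))
  have := hb k
  omega

/-- In a finitary framework there is an infinite admissible extension iff some argument is in
an admissible extension but in no finite one, or the finite ones are unbounded. -/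
theorem exists_infinite_iff {F : ArgFramework ℕ} (hF : ∀ a, {b | F.attacks b a}.Finite)
    {K L : Set ℕ} :
    (∃ S ∈ F.adBetween K L, S.Infinite) ↔
      (∃ a, (∀ T ∈ F.adBetween K L, T.Finite → a ∉ T) ∧ ∃ S ∈ F.adBetween K L, a ∈ S) ∨
      ∀ N, ∃ T ∈ F.adBetween K L, T.Finite ∧ ∃ b ∈ T, N ≤ b := by
  constructor
  · rintro ⟨S, hS, hinf⟩
    rw [or_iff_not_imp_right]
    intro h
    push Not at h
    obtain ⟨N, hN⟩ := h
    obtain ⟨a, ha, hNa⟩ := hinf.exists_gt N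
    exact ⟨a, fun T hT hfin haT => (hN T hT hfin a haT).not_ge hNa.le, S, hS, ha⟩
  · rintro (⟨a, ha, S, hS, haS⟩ | h)
    · exact ⟨S, hS, fun hfin => ha S hS hfin haS⟩
    · exact exists_infinite_of_unbounded hF fun N =>
        let ⟨T, hT, _, hb⟩ := h N
        ⟨T, hT, hb⟩

end ArgFramework

namespace FinitaryAF

theorem mem_canonicalSet {n y : ℕ} : n ∈ canonicalSet y ↔ y.testBit n := by
  simp [canonicalSet]

theorem canonicalSet_zero : canonicalSet 0 = ∅ := by simp [canonicalSet]

theorem canonicalSet_two_pow (n : ℕ) : canonicalSet (2 ^ n) = {n} := by simp [canonicalSet]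

theorem exists_canonicalSet_eq (s : Finset ℕ) : ∃ t, canonicalSet t = s :=
  ⟨_, Finset.toFinset_bitIndices_sum_two_pow s⟩

theorem lt_two_pow_of_canonicalSet {t k : ℕ} (h : ∀ i ∈ canonicalSet t, i < k) : t < 2 ^ k := by
  refine Nat.lt_pow_two_of_testBit t fun i hi => ?_
  by_contra hc
  exact (h i (mem_canonicalSet.2 (by simpa using hc))).not_ge hi

/-! ### Approximation by stages and the arithmetical form -/

section Stage

/-- The finite set with index `t` is admissible according to the partial information `g` about
the attackers, which must settle all requirements. -/
def Certified (g : ℕ → Option ℕ) (t : ℕ) : Prop :=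
  ∀ a ∈ canonicalSet t, ∃ y ∈ g a, ∀ b ∈ canonicalSet y, b ∉ canonicalSet t ∧
    ∃ z ∈ g b, ∃ c ∈ canonicalSet z, c ∈ canonicalSet t

/-- The partial information `g` about the attackers does not refute that the finite set with
index `t` is the trace on `{0, …, k - 1}` of an admissible set. -/
def Plausible (g : ℕ → Option ℕ) (k t : ℕ) : Prop :=
  ∀ a ∈ canonicalSet t, ∀ y ∈ g a, ∀ b ∈ canonicalSet y, b ∉ canonicalSet t ∧
    ∀ z ∈ g b, ∃ c ∈ canonicalSet z, c ∈ canonicalSet t ∨ k ≤ c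

variable {F : ArgFramework ℕ} {f : ℕ → ℕ} {g : ℕ → ℕ → Option ℕ}

/-- Admissibility of a finite set depends on finitely many values of `f`, which are all available at
some stage. -/
theorem exists_certified_iff (hF : ∀ n m, F.attacks n m ↔ n ∈ canonicalSet (f m))
    (hs : ∀ k m y, y ∈ g k m → y = f m) (hc : ∀ m, ∀ᶠ k in atTop, f m ∈ g k m) {t : ℕ} :
    (∃ k, Certified (g k) t) ↔ (canonicalSet t : Set ℕ) ∈ F.ad := by
  rw [ArgFramework.mem_ad_iff]
  simp only [hF, Finset.mem_coe]
  constructor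
  · rintro ⟨k, hk⟩ a ha b hb
    obtain ⟨y, hy, h⟩ := hk a ha
    obtain rfl := hs _ _ _ hy
    obtain ⟨h1, z, hz, h2⟩ := h b hb
    obtain rfl := hs _ _ _ hz
    exact ⟨h1, h2⟩
  · intro h
    have h1 : ∀ᶠ k in atTop, ∀ a ∈ canonicalSet t, f a ∈ g k a ∧
        ∀ b ∈ canonicalSet (f a), f b ∈ g k b := by
      rw [eventually_all_finset]
      intro a _
      refine (hc a).and ?_
      rw [eventually_all_finset]
      exact fun b _ => hc b
    obtain ⟨k, hk⟩ := h1.exists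
    exact ⟨k, fun a ha => ⟨f a, (hk a ha).1, fun b hb =>
      ⟨(h a ha b hb).1, f b, (hk a ha).2 b hb, (h a ha b hb).2⟩⟩⟩

theorem finite_attackers (hF : ∀ n m, F.attacks n m ↔ n ∈ canonicalSet (f m)) (a : ℕ) :
    {b | F.attacks b a}.Finite := by
  simp only [hF]
  exact (canonicalSet (f a)).finite_toSet

/-- Compactness: traces of an admissible set are plausible, and conversely an ultralimit of
plausible traces is admissible. The traces need not cohere. -/
theorem exists_adBetween_iff (hF : ∀ n m, F.attacks n m ↔ n ∈ canonicalSet (f m))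
    (hs : ∀ k m y, y ∈ g k m → y = f m) (hc : ∀ m, ∀ᶠ k in atTop, f m ∈ g k m)
    {K L : Set ℕ} :
    (∃ S, S ∈ F.adBetween K L) ↔ ∀ k, ∃ t < 2 ^ k, Plausible (g k) k t ∧
      (∀ a ∈ K, a ∈ canonicalSet t ∨ k ≤ a) ∧ ∀ a ∈ L, a ∉ canonicalSet t := by
  constructor
  · rintro ⟨S, hS, hK, hL⟩ k
    classical
    obtain ⟨t, ht⟩ := exists_canonicalSet_eq ((Finset.range k).filter (· ∈ S))
    have hmem (a : ℕ) : a ∈ canonicalSet t ↔ a < k ∧ a ∈ S := by simp [ht]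
    refine ⟨t, lt_two_pow_of_canonicalSet fun i hi => ((hmem i).1 hi).1, ?_, ?_, ?_⟩
    · intro a ha y hy b hb
      obtain rfl := hs _ _ _ hy
      obtain ⟨h1, c, hc, hcS⟩ :=
        ArgFramework.mem_ad_iff.1 hS a ((hmem a).1 ha).2 b ((hF _ _).2 hb)
      refine ⟨fun hb => h1 ((hmem b).1 hb).2, fun z hz => ?_⟩
      obtain rfl := hs _ _ _ hz
      refine ⟨c, (hF _ _).1 hc, ?_⟩
      rw [hmem]
      by_cases h : c < k
      · exact Or.inl ⟨h, hcS⟩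
      · exact Or.inr (not_lt.1 h)
    · intro a ha
      rw [hmem]
      by_cases h : a < k
      · exact Or.inl ⟨h, hK ha⟩
      · exact Or.inr (not_lt.1 h)
    · exact fun a ha hat => Set.disjoint_right.1 hL ha ((hmem a).1 hat).2
  · intro h
    choose t _ hP hK hL using h
    refine ⟨_, ArgFramework.ultralimit_mem_adBetween (T := fun k => ↑(canonicalSet (t k)))
      (finite_attackers hF) ?_ ?_ ?_⟩
    · intro a b hba
      -- Once `k` exceeds all attackers of `b`, the escape clause `k ≤ c` is void.
      have hbd : ∀ᶠ k in atTop, ∀ c ∈ canonicalSet (f b), c < k := by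
        rw [eventually_all_finset]
        exact fun c _ => eventually_gt_atTop c
      filter_upwards [hc a, hc b, hbd] with k h1 h2 h3 ha
      obtain ⟨h4, h5⟩ := hP k a ha _ h1 b ((hF _ _).1 hba)
      obtain ⟨c, hcb, hct⟩ := h5 _ h2
      exact ⟨h4, c, (hF _ _).2 hcb, hct.resolve_right (h3 c hcb).not_ge⟩
    · intro a ha
      filter_upwards [eventually_gt_atTop a] with k hk
      exact (hK k a ha).resolve_right hk.not_ge
    · exact fun a ha => .of_forall fun k => hL k a ha

/-- The matrix of the `Σ⁰₂` part of the existence of an infinite admissible set between the sets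
with indices `u` and `v`. -/
def SigmaMatrix (g : ℕ → ℕ → Option ℕ) (u v a k s : ℕ) : Prop :=
  (Certified (g k) s ∧ (∀ m ∈ canonicalSet u, m ∈ canonicalSet s) ∧
    (∀ m ∈ canonicalSet v, m ∉ canonicalSet s) → a ∉ canonicalSet s) ∧
  ∃ t < 2 ^ k, Plausible (g k) k t ∧ ((a ∈ canonicalSet t ∨ k ≤ a) ∧
    ∀ m ∈ canonicalSet u, m ∈ canonicalSet t ∨ k ≤ m) ∧
    ∀ m ∈ canonicalSet v, m ∉ canonicalSet t

/-- The matrix of the `Π⁰₂` part of the existence of an infinite admissible set between the sets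
with indices `u` and `v`. -/
def PiMatrix (g : ℕ → ℕ → Option ℕ) (u v N k s : ℕ) : Prop :=
  Certified (g k) s ∧ (∀ m ∈ canonicalSet u, m ∈ canonicalSet s) ∧
    (∀ m ∈ canonicalSet v, m ∉ canonicalSet s) ∧ ∃ b ∈ canonicalSet s, N ≤ b

theorem exists_finite_iff (hF : ∀ n m, F.attacks n m ↔ n ∈ canonicalSet (f m))
    (hs : ∀ k m y, y ∈ g k m → y = f m) (hc : ∀ m, ∀ᶠ k in atTop, f m ∈ g k m)
    {u v : ℕ} (P : Set ℕ → Prop) :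
    (∃ T ∈ F.adBetween (canonicalSet u) (canonicalSet v), T.Finite ∧ P T) ↔
      ∃ k s, Certified (g k) s ∧ (∀ m ∈ canonicalSet u, m ∈ canonicalSet s) ∧
        (∀ m ∈ canonicalSet v, m ∉ canonicalSet s) ∧ P (canonicalSet s) := by
  constructor
  · rintro ⟨T, ⟨hT, hu, hv⟩, hfin, hP⟩
    obtain ⟨s, hsT⟩ := exists_canonicalSet_eq hfin.toFinset
    have hsT' : (canonicalSet s : Set ℕ) = T := by simp [hsT]
    subst hsT'
    obtain ⟨k, hk⟩ := (exists_certified_iff hF hs hc).2 hT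
    exact ⟨k, s, hk, fun m hm => hu hm, fun m hm => Set.disjoint_right.1 hv hm, hP⟩
  · rintro ⟨k, s, hk, hu, hv, hP⟩
    exact ⟨_, ⟨(exists_certified_iff hF hs hc).1 ⟨k, hk⟩, fun m hm => hu m hm,
      Set.disjoint_right.2 fun m hm => hv m hm⟩, Finset.finite_toSet _, hP⟩

/-- The two Π⁰₁ conditions on `a` share the universal variable `k`, as stage of certification and as
length of the trace. -/
theorem exists_infinite_iff_matrix (hF : ∀ n m, F.attacks n m ↔ n ∈ canonicalSet (f m))
    (hs : ∀ k m y, y ∈ g k m → y = f m) (hc : ∀ m, ∀ᶠ k in atTop, f m ∈ g k m)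
    {u v : ℕ} :
    (∃ S ∈ F.adBetween (canonicalSet u) (canonicalSet v), S.Infinite) ↔
      (∃ a, ∀ w : ℕ × ℕ, SigmaMatrix g u v a w.1 w.2) ∨
      ∀ N, ∃ w : ℕ × ℕ, PiMatrix g u v N w.1 w.2 := by
  rw [ArgFramework.exists_infinite_iff (finite_attackers hF)]
  refine or_congr (exists_congr fun a => ?_) (forall_congr' fun N => ?_)
  · have h1 : (∀ T ∈ F.adBetween (canonicalSet u) (canonicalSet v), T.Finite → a ∉ T) ↔
        ¬ ∃ T ∈ F.adBetween (canonicalSet u) (canonicalSet v), T.Finite ∧ a ∈ T := by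
      push Not; rfl
    have h2 : (∃ S ∈ F.adBetween (canonicalSet u) (canonicalSet v), a ∈ S) ↔
        ∃ S, S ∈ F.adBetween (insert a (canonicalSet u : Set ℕ)) (canonicalSet v) := by
      refine exists_congr fun S => ?_
      simp only [ArgFramework.adBetween, Set.mem_ofPred_eq, Set.insert_subset_iff]
      tauto
    rw [h1, exists_finite_iff hF hs hc, h2, exists_adBetween_iff hF hs hc]
    simp only [SigmaMatrix, Set.forall_mem_insert, Finset.mem_coe, Prod.forall]
    constructor
    · rintro ⟨h, h'⟩ k s
      exact ⟨fun ⟨h3, h4, h5⟩ h6 => h ⟨k, s, h3, h4, h5, h6⟩, h' k⟩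
    · intro h
      -- The second conjunct does not depend on `s`, so `0` is an arbitrary choice.
      exact ⟨fun ⟨k, s, h3, h4, h5, h6⟩ => (h k s).1 ⟨h3, h4, h5⟩ h6, fun k => (h k 0).2⟩
  · rw [exists_finite_iff hF hs hc]
    simp only [PiMatrix, Finset.mem_coe, Prod.exists]

end Stage

/-! ### Computability of the matrices -/

section Computability

open Primrec

theorem primrec₂_pow : Primrec₂ ((· ^ ·) : ℕ → ℕ → ℕ) :=
  Primrec₂.unpaired'.1 Nat.Primrec.pow

theorem primrecRel_mem_canonicalSet : PrimrecRel fun n y : ℕ => n ∈ canonicalSet y := by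
  have h : PrimrecPred fun q : ℕ × ℕ => q.2 / 2 ^ q.1 % 2 = 1 :=
    Primrec.eq.comp (nat_mod.comp (nat_div.comp snd (primrec₂_pow.comp (const 2) fst))
      (const 2)) (const 1)
  exact h.of_eq fun q => by simp [mem_canonicalSet, Nat.testBit_eq_decide_div_mod_eq]

variable {α : Type*} [Primcodable α]

theorem primrecPred_mem_canonicalSet {f g : α → ℕ} (hf : Primrec f) (hg : Primrec g) :
    PrimrecPred fun x => f x ∈ canonicalSet (g x) := primrecRel_mem_canonicalSet.comp hf hg

theorem primrecPred_exists_lt {f : α → ℕ} (hf : Primrec f) {R : α → ℕ → Prop}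
    (hR : PrimrecPred fun q : α × ℕ => R q.1 q.2) : PrimrecPred fun x => ∃ b < f x, R x b := by
  have h : PrimrecRel fun (b : ℕ) (x : α) => R x b := hR.comp (snd.pair fst)
  exact (h.exists_mem_list.comp (list_range.comp hf) Primrec.id).of_eq fun x => by simp

theorem primrecPred_exists_mem_canonicalSet {f : α → ℕ} (hf : Primrec f) {R : α → ℕ → Prop}
    (hR : PrimrecPred fun q : α × ℕ => R q.1 q.2) :
    PrimrecPred fun x => ∃ b ∈ canonicalSet (f x), R x b := by
  refine (primrecPred_exists_lt hf (R := fun x b => b ∈ canonicalSet (f x) ∧ R x b)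
    ((primrecPred_mem_canonicalSet snd (hf.comp fst)).and hR)).of_eq fun x => ?_
  refine exists_congr fun b => ⟨fun h => h.2, fun h => ⟨?_, h⟩⟩
  -- Elements of `canonicalSet y` are less than `y`, which makes the quantifier bounded.
  exact b.lt_two_pow_self.trans_le (Nat.ge_two_pow_of_testBit (mem_canonicalSet.1 h.1))

theorem primrecPred_forall_mem_canonicalSet {f : α → ℕ} (hf : Primrec f) {R : α → ℕ → Prop}
    (hR : PrimrecPred fun q : α × ℕ => R q.1 q.2) :
    PrimrecPred fun x => ∀ b ∈ canonicalSet (f x), R x b :=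
  (primrecPred_exists_mem_canonicalSet hf (R := fun x b => ¬ R x b) hR.not).not.of_eq fun x => by simp

theorem primrecPred_exists_mem_option {f : α → Option ℕ} (hf : Primrec f) {R : α → ℕ → Prop}
    (hR : PrimrecPred fun q : α × ℕ => R q.1 q.2) :
    PrimrecPred fun x => ∃ b ∈ f x, R x b := by
  have h : PrimrecRel fun (b : ℕ) (x : α) => R x b := hR.comp (snd.pair fst)
  have hl : Primrec fun x => (f x).toList :=
    (option_casesOn hf (const []) (list_cons.comp snd (const [])).to₂).of_eq fun x => by
      cases f x <;> rfl
  exact (h.exists_mem_list.comp hl Primrec.id).of_eq fun x => by simp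

theorem primrecPred_forall_mem_option {f : α → Option ℕ} (hf : Primrec f) {R : α → ℕ → Prop}
    (hR : PrimrecPred fun q : α × ℕ => R q.1 q.2) :
    PrimrecPred fun x => ∀ b ∈ f x, R x b :=
  (primrecPred_exists_mem_option hf (R := fun x b => ¬ R x b) hR.not).not.of_eq fun x => by simp

variable {g : α → ℕ → Option ℕ} {u v a k t : α → ℕ}

theorem primrecPred_certified (hg : Primrec₂ g) (ht : Primrec t) :
    PrimrecPred fun x => Certified (g x) (t x) := by
  unfold Certified
  refine primrecPred_forall_mem_canonicalSet ht <|
    primrecPred_exists_mem_option (hg.comp fst snd) <|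
    primrecPred_forall_mem_canonicalSet snd <| .and
      (primrecPred_mem_canonicalSet snd (ht.comp (fst.comp (fst.comp fst)))).not <|
    primrecPred_exists_mem_option (hg.comp (fst.comp (fst.comp fst)) snd) <|
    primrecPred_exists_mem_canonicalSet snd <|
    primrecPred_mem_canonicalSet snd
      (ht.comp (fst.comp (fst.comp (fst.comp (fst.comp fst)))))

theorem primrecPred_plausible (hg : Primrec₂ g) (hk : Primrec k) (ht : Primrec t) :
    PrimrecPred fun x => Plausible (g x) (k x) (t x) := by
  unfold Plausible
  refine primrecPred_forall_mem_canonicalSet ht <|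
    primrecPred_forall_mem_option (hg.comp fst snd) <|
    primrecPred_forall_mem_canonicalSet snd <| .and
      (primrecPred_mem_canonicalSet snd (ht.comp (fst.comp (fst.comp fst)))).not <|
    primrecPred_forall_mem_option (hg.comp (fst.comp (fst.comp fst)) snd) <|
    primrecPred_exists_mem_canonicalSet snd <| .or
    (primrecPred_mem_canonicalSet snd
      (ht.comp (fst.comp (fst.comp (fst.comp (fst.comp fst))))))
    (nat_le.comp (hk.comp (fst.comp (fst.comp (fst.comp (fst.comp fst))))) snd)

theorem primrecPred_subset (hu : Primrec u) (ht : Primrec t) :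
    PrimrecPred fun x => ∀ m ∈ canonicalSet (u x), m ∈ canonicalSet (t x) :=
  primrecPred_forall_mem_canonicalSet hu (primrecPred_mem_canonicalSet snd (ht.comp fst))

theorem primrecPred_disjoint (hv : Primrec v) (ht : Primrec t) :
    PrimrecPred fun x => ∀ m ∈ canonicalSet (v x), m ∉ canonicalSet (t x) :=
  primrecPred_forall_mem_canonicalSet hv (primrecPred_mem_canonicalSet snd (ht.comp fst)).not

theorem primrec₂_stage {g : α → ℕ → ℕ → Option ℕ}
    (hg : Primrec fun q : α × ℕ × ℕ => g q.1 q.2.1 q.2.2) (hk : Primrec k) :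
    Primrec₂ fun x => g x (k x) := hg.comp (fst.pair ((hk.comp fst).pair snd))

theorem primrecPred_piMatrix {g : α → ℕ → ℕ → Option ℕ}
    (hg : Primrec fun q : α × ℕ × ℕ => g q.1 q.2.1 q.2.2) (hu : Primrec u) (hv : Primrec v)
    (ha : Primrec a) (hk : Primrec k) (ht : Primrec t) :
    PrimrecPred fun x => PiMatrix (g x) (u x) (v x) (a x) (k x) (t x) :=
  (primrecPred_certified (primrec₂_stage hg hk) ht).and <|
    (primrecPred_subset hu ht).and <| (primrecPred_disjoint hv ht).and <|
      primrecPred_exists_mem_canonicalSet ht (nat_le.comp (ha.comp fst) snd)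

theorem primrecPred_sigmaMatrix {g : α → ℕ → ℕ → Option ℕ}
    (hg : Primrec fun q : α × ℕ × ℕ => g q.1 q.2.1 q.2.2) (hu : Primrec u) (hv : Primrec v)
    (ha : Primrec a) (hk : Primrec k) (ht : Primrec t) :
    PrimrecPred fun x => SigmaMatrix (g x) (u x) (v x) (a x) (k x) (t x) := by
  have h1 : PrimrecPred fun x => Certified (g x (k x)) (t x) ∧
      (∀ m ∈ canonicalSet (u x), m ∈ canonicalSet (t x)) ∧
      (∀ m ∈ canonicalSet (v x), m ∉ canonicalSet (t x)) →
        a x ∉ canonicalSet (t x) :=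
    (((primrecPred_certified (primrec₂_stage hg hk) ht).and <|
      (primrecPred_subset hu ht).and (primrecPred_disjoint hv ht)).not.or
      (primrecPred_mem_canonicalSet ha ht).not).of_eq fun x => imp_iff_not_or.symm
  refine h1.and <| primrecPred_exists_lt (primrec₂_pow.comp (const 2) hk) <|
    (primrecPred_plausible (g := fun q : α × ℕ => g q.1 (k q.1))
      ((primrec₂_stage hg hk).comp (fst.comp fst) snd) (hk.comp fst) snd).and <| .and (.and ?_ ?_) ?_
  · exact (primrecPred_mem_canonicalSet (ha.comp fst) snd).or
      (nat_le.comp (hk.comp fst) (ha.comp fst))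
  · exact primrecPred_forall_mem_canonicalSet (hu.comp fst) <|
      (primrecPred_mem_canonicalSet snd (snd.comp fst)).or
        (nat_le.comp (hk.comp (fst.comp fst)) snd)
  · exact primrecPred_disjoint (hv.comp fst) snd

/-- One code computes `φ` on pairs; running it with fuel `k` is primitive recursive and monotone in
`k`. -/
theorem exists_stage_approximation {φ : ℕ → ℕ →. ℕ} (hφ : Partrec₂ φ) :
    ∃ ev : ℕ → ℕ → ℕ → Option ℕ, (Primrec fun q : ℕ × ℕ × ℕ => ev q.1 q.2.1 q.2.2) ∧
      (∀ e k m y, y ∈ ev e k m → y ∈ φ e m) ∧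
      ∀ e m y, y ∈ φ e m → ∀ᶠ k in atTop, y ∈ ev e k m := by
  obtain ⟨c, hc⟩ := Nat.Partrec.Code.exists_code.1
    (Partrec.nat_iff.1 (hφ.comp (Computable.fst.comp .unpair) (Computable.snd.comp .unpair)))
  have hev (e m : ℕ) : c.eval (Nat.pair e m) = φ e m := by rw [hc]; simp
  refine ⟨fun e k m => c.evaln k (Nat.pair e m), ?_, ?_, ?_⟩
  · exact Nat.Partrec.Code.primrec_evaln.comp
      (((fst.comp snd).pair (const c)).pair (Primrec₂.natPair.comp fst (snd.comp snd)))
  · intro e k m y hy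
    rw [← hev]
    exact Nat.Partrec.Code.evaln_sound hy
  · intro e m y hy
    rw [← hev, Nat.Partrec.Code.evaln_complete] at hy
    obtain ⟨k₀, hk₀⟩ := hy
    filter_upwards [eventually_ge_atTop k₀] with k hk
    exact Nat.Partrec.Code.evaln_mono hk hk₀

theorem _root_.ComputablePred.and_of {p q : α → Prop} (hp : ComputablePred p)
    (hq : ComputablePred q) : ComputablePred fun x => p x ∧ q x := by
  classical
  refine ComputablePred.computable_iff.2 ⟨fun x => decide (p x) && decide (q x),
    Primrec.and.to_comp.comp hp.decide hq.decide, ?_⟩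
  simp

theorem _root_.ComputablePred.comp_of {β : Type*} [Primcodable β] {p : β → Prop} {f : α → β}
    (hp : ComputablePred p) (hf : Computable f) : ComputablePred fun x => p (f x) := by
  classical
  exact ComputablePred.computable_iff.2 ⟨fun x => decide (p (f x)), hp.decide.comp hf, by simp⟩

/-- Lets the quantifiers range over tuples. Numbers that decode to nothing stand for `default`,
which adds no new instance. -/
theorem isSigma2_of_primcodable {β γ : Type} [Primcodable β] [Primcodable γ] [Inhabited β]
    [Inhabited γ] {X : Set ℕ} {R : ℕ → β → γ → Prop}
    (hR : ComputablePred fun t : ℕ × β × γ => R t.1 t.2.1 t.2.2)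
    (hX : ∀ x, x ∈ X ↔ ∃ y, ∀ z, R x y z) : IsSigma2 X := by
  refine ⟨fun x y z => R x ((Encodable.decode y).getD default)
    ((Encodable.decode z).getD default), ?_, fun x => ?_⟩
  · have hd {δ : Type} [Primcodable δ] [Inhabited δ] :
        Primrec fun n : ℕ => ((Encodable.decode n : Option δ).getD default) :=
      option_getD_default.comp Primrec.decode
    exact hR.comp_of (fst.pair ((hd.comp (fst.comp snd)).pair (hd.comp (snd.comp snd)))).to_comp
  · rw [hX]
    constructor
    · rintro ⟨y, hy⟩
      exact ⟨Encodable.encode y, fun z => by simpa using hy _⟩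
    · rintro ⟨y, hy⟩
      exact ⟨_, fun z => by simpa using hy (Encodable.encode z)⟩

end Computability

/-! ### The uniform u-Σ⁰₂ bound -/

/-- Uniformly in an index of a framework and in indices of finite sets `K` and `L`, the existence
of an infinite admissible extension that includes `K` and is disjoint from `L` is `u-Σ⁰₂`. -/
theorem exists_isUSigma2 {φ : ℕ → ℕ →. ℕ} (hφ : Partrec₂ φ) {ι : Type} [Primcodable ι] [Inhabited ι]
    {q : ι → ℕ} (hq : Computable q) (hb : Function.Bijective q) {e u v : ι → ℕ}
    (he : Computable e) (hu : Computable u) (hv : Computable v) :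
    ∃ X, IsUSigma2 X ∧ ∀ i F, IsIndex φ (e i) F →
      (q i ∈ X ↔ ∃ S ∈ F.adBetween (canonicalSet (u i)) (canonicalSet (v i)), S.Infinite) := by
  obtain ⟨ev, hev, hsound, hcomplete⟩ := exists_stage_approximation hφ
  have hparam : Computable fun t : ℕ × (ι × ℕ) × (ℕ × ℕ) =>
      ((e t.2.1.1, u t.2.1.1, v t.2.1.1), t.2.1.2, t.2.2) :=
    ((he.pair (hu.pair hv)).comp (Primrec.fst.comp (Primrec.fst.comp Primrec.snd)).to_comp).pair
      ((Primrec.snd.comp (Primrec.fst.comp Primrec.snd)).pair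
        (Primrec.snd.comp Primrec.snd)).to_comp
  have hqt : ComputablePred fun t : ℕ × (ι × ℕ) × (ℕ × ℕ) => q t.2.1.1 = t.1 :=
    (PrimrecPred.computablePred Primrec.eq).comp_of
      ((hq.comp (Primrec.fst.comp (Primrec.fst.comp Primrec.snd)).to_comp).pair Computable.fst)
  have hg : Primrec fun w : ((ℕ × ℕ × ℕ) × ℕ × (ℕ × ℕ)) × ℕ × ℕ =>
      ev w.1.1.1 w.2.1 w.2.2 :=
    hev.comp ((Primrec.fst.comp (Primrec.fst.comp Primrec.fst)).pair Primrec.snd)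
  have hu' : Primrec fun w : (ℕ × ℕ × ℕ) × ℕ × (ℕ × ℕ) => w.1.2.1 :=
    Primrec.fst.comp (Primrec.snd.comp Primrec.fst)
  have hv' : Primrec fun w : (ℕ × ℕ × ℕ) × ℕ × (ℕ × ℕ) => w.1.2.2 :=
    Primrec.snd.comp (Primrec.snd.comp Primrec.fst)
  have ha : Primrec fun w : (ℕ × ℕ × ℕ) × ℕ × (ℕ × ℕ) => w.2.1 := Primrec.fst.comp Primrec.snd
  have hk : Primrec fun w : (ℕ × ℕ × ℕ) × ℕ × (ℕ × ℕ) => w.2.2.1 :=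
    Primrec.fst.comp (Primrec.snd.comp Primrec.snd)
  have hs : Primrec fun w : (ℕ × ℕ × ℕ) × ℕ × (ℕ × ℕ) => w.2.2.2 :=
    Primrec.snd.comp (Primrec.snd.comp Primrec.snd)
  -- The search for the preimage `i` of `x` is absorbed into the existential quantifier, so no
  -- inverse of `q` is computed.
  have hY : IsSigma2 {x | ∃ i, q i = x ∧ ∃ a, ∀ w : ℕ × ℕ,
      SigmaMatrix (ev (e i)) (u i) (v i) a w.1 w.2} := by
    have hM : PrimrecPred fun w : (ℕ × ℕ × ℕ) × ℕ × (ℕ × ℕ) =>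
        SigmaMatrix (ev w.1.1) w.1.2.1 w.1.2.2 w.2.1 w.2.2.1 w.2.2.2 :=
      primrecPred_sigmaMatrix (g := fun w => ev w.1.1) hg hu' hv' ha hk hs
    have hM' := hM.computablePred.comp_of hparam
    refine isSigma2_of_primcodable (hqt.and_of hM')
      (R := fun x (y : ι × ℕ) (w : ℕ × ℕ) => q y.1 = x ∧
        SigmaMatrix (ev (e y.1)) (u y.1) (v y.1) y.2 w.1 w.2) fun x => ?_
    simp only [Set.mem_ofPred_eq, Prod.exists, forall_and, forall_const, exists_and_left]
  have hZ : IsPi2 {x | ∃ i, q i = x ∧ ∀ N, ∃ w : ℕ × ℕ,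
      PiMatrix (ev (e i)) (u i) (v i) N w.1 w.2} := by
    have hM : PrimrecPred fun w : (ℕ × ℕ × ℕ) × ℕ × (ℕ × ℕ) =>
        ¬ PiMatrix (ev w.1.1) w.1.2.1 w.1.2.2 w.2.1 w.2.2.1 w.2.2.2 :=
      (primrecPred_piMatrix (g := fun w => ev w.1.1) hg hu' hv' ha hk hs).not
    have hM' := hM.computablePred.comp_of hparam
    refine isSigma2_of_primcodable (hqt.and_of hM')
      (R := fun x (y : ι × ℕ) (w : ℕ × ℕ) => q y.1 = x ∧
        ¬ PiMatrix (ev (e y.1)) (u y.1) (v y.1) y.2 w.1 w.2) fun x => ?_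
    -- The preimage `i` is unique, so complementing negates only the condition on `i` and the form
    -- `∃ i` survives.
    obtain ⟨i, rfl⟩ := hb.2 x
    simp only [Set.mem_compl_iff, Set.mem_ofPred_eq, hb.1.eq_iff, exists_eq_left,
      forall_and, forall_const, Prod.exists, exists_and_left]
    push Not
    simp only [Prod.forall]
  refine ⟨_, ⟨_, _, hY, hZ, rfl⟩, fun i F hF => ?_⟩
  have hdom : e i ∈ tot φ := exists_isIndex_iff.1 ⟨F, hF⟩
  have hget (m y : ℕ) (hy : y ∈ φ (e i) m) : y = (φ (e i) m).get (hdom m) :=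
    Part.mem_unique hy (Part.get_mem _)
  rw [exists_infinite_iff_matrix (f := fun m => (φ (e i) m).get (hdom m)) (g := ev (e i))
    (fun n m => ?_) (fun k m y hy => hget m y (hsound _ _ _ _ hy))
    (fun m => hcomplete _ _ _ (Part.get_mem _))]
  · simp only [Set.mem_union, Set.mem_ofPred_eq, hb.1.eq_iff, exists_eq_left]
  · obtain ⟨y, hy, h⟩ := hF n m
    rw [h, hget m y hy]

end FinitaryAF

/-! ### The three decision problems -/

theorem mainTheorem3 (φ : ℕ → ℕ →. ℕ) (hφ : FinitaryAF.IsComputableEnumeration φ)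
    (p : ℕ → ℕ → ℕ) (hp : FinitaryAF.IsPairing p) :
    FinitaryAF.IsWithin FinitaryAF.IsUSigma2 (FinitaryAF.tot φ) (FinitaryAF.existsInfad φ) ∧
    FinitaryAF.IsWithin FinitaryAF.IsUSigma2 (FinitaryAF.totProd φ p)
      (FinitaryAF.credInfad φ p) ∧
    FinitaryAF.IsWithin FinitaryAF.IsDSigma2 (FinitaryAF.totProd φ p)
      (FinitaryAF.skepInfad φ p) := by
  open FinitaryAF in
  -- `2 ^ n` is the canonical index of `{n}` and `0` that of `∅`.
  have hpow : Computable fun t : ℕ × ℕ => 2 ^ t.2 :=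
    (primrec₂_pow.comp (Primrec.const 2) Primrec.snd).to_comp
  have hinj (e n e' n' : ℕ) (h : p e n = p e' n') : e = e' ∧ n = n' := by
    simpa using hp.2.1 (a₁ := (e, n)) (a₂ := (e', n')) h
  refine ⟨?_, ?_, ?_⟩
  · obtain ⟨X, hX, h⟩ := exists_isUSigma2 hφ.1 (q := fun x : ℕ => x) Computable.id
      Function.bijective_id (e := fun x => x) (u := fun _ => 0) (v := fun _ => 0)
      Computable.id (Computable.const 0) (Computable.const 0)
    have key (e F) (hF : IsIndex φ e F) : e ∈ X ↔ ∃ S, S ∈ F.infad := by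
      rw [h e F hF]
      simp [ArgFramework.adBetween, ArgFramework.infad, canonicalSet_zero]
    refine ⟨X, hX, Set.ext fun e => ⟨?_, ?_⟩⟩
    · rintro ⟨F, hF, hS⟩
      exact ⟨(key e F hF).2 hS, exists_isIndex_iff.1 ⟨F, hF⟩⟩
    · rintro ⟨heX, he⟩
      obtain ⟨F, hF⟩ := exists_isIndex_iff.2 he
      exact ⟨F, hF, (key e F hF).1 heX⟩
  · obtain ⟨X, hX, h⟩ := exists_isUSigma2 hφ.1 hp.1 hp.2 (u := fun t => 2 ^ t.2)
      (v := fun _ => 0) Computable.fst hpow (Computable.const 0)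
    have key (e n F) (hF : IsIndex φ e F) : p e n ∈ X ↔ ∃ S ∈ F.infad, n ∈ S := by
      rw [h (e, n) F hF]
      simp [ArgFramework.adBetween, ArgFramework.infad, canonicalSet_zero, canonicalSet_two_pow,
        and_assoc, and_comm]
    refine ⟨X, hX, Set.ext fun x => ⟨?_, ?_⟩⟩
    · rintro ⟨e, n, rfl, F, hF, hS⟩
      exact ⟨(key e n F hF).2 hS, e, exists_isIndex_iff.1 ⟨F, hF⟩, n, rfl⟩
    · rintro ⟨hxX, e, he, n, rfl⟩
      obtain ⟨F, hF⟩ := exists_isIndex_iff.2 he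
      exact ⟨e, n, rfl, F, hF, (key e n F hF).1 hxX⟩
  · obtain ⟨X, ⟨Y, Z, hY, hZ, rfl⟩, h⟩ := exists_isUSigma2 hφ.1 hp.1 hp.2 (u := fun _ => 0)
      (v := fun t => 2 ^ t.2) Computable.fst (Computable.const 0) hpow
    have key (e n F) (hF : IsIndex φ e F) :
        p e n ∈ (Y ∪ Z)ᶜ ↔ ∀ S ∈ F.infad, n ∈ S := by
      rw [Set.mem_compl_iff, h (e, n) F hF]
      simp only [ArgFramework.adBetween, ArgFramework.infad, canonicalSet_zero,
        canonicalSet_two_pow, Set.mem_ofPred_eq, Finset.coe_empty, Set.empty_subset, true_and,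
        Finset.coe_singleton, Set.disjoint_singleton_right, not_exists, not_and, and_imp]
      exact forall_congr' fun S => ⟨fun h h1 h2 => by_contra fun h3 => h h1 h3 h2,
        fun h h1 h3 h2 => h3 (h h1 h2)⟩
    -- Complements exchange Σ⁰₂ and Π⁰₂, so `Zᶜ` is the Σ⁰₂ part and `Yᶜ` the Π⁰₂ part.
    refine ⟨(Y ∪ Z)ᶜ, ⟨Zᶜ, Yᶜ, hZ, by rwa [IsPi2, compl_compl], ?_⟩,
      Set.ext fun x => ⟨?_, ?_⟩⟩
    · rw [Set.compl_union, Set.inter_comm]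
    · rintro ⟨e, n, rfl, F, hF, hS⟩
      exact ⟨(key e n F hF).2 hS, e, exists_isIndex_iff.1 ⟨F, hF⟩, n, rfl⟩
    · rintro ⟨hxX, e, he, n, rfl⟩
      obtain ⟨F, hF⟩ := exists_isIndex_iff.2 he
      exact ⟨e, n, rfl, F, hF, (key e n F hF).1 hxX⟩
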